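/- Let $Z$ be a random element of a measurable space $\mathcal Z$ with law $\mathbb D$, let $\mathcal F$ be a class of measurable functions $f:\mathcal Z\to[0,\infty)$ (the losses), and write $P(f)=\mathrm E[f(Z)]$. Assume that there is $\sigma>0$ with $\mathrm E[f(Z)^2]\le\sigma^2$ for every $f\in\mathcal F$, and that $f^*\in\mathcal F$ minimizes $P$ over $\mathcal F$. Let $(\phi_\alpha)_{\alpha>0}$, $\phi_\alpha:[0,\infty)\to[0,\infty)$, be a family of truncation functions with constant $M>0$: for every $\alpha>0$, (i) $\phi_\alpha$ is differentiable with Lipschitz continuous derivative; (ii) $\phi_\alpha'(0)=1$ and $\phi_\alpha'(x)\to0$ as $x\to\infty$; (iii) $\phi_\alpha'$ is non-increasing; (iv) $|\phi_\alpha(x)-x|\le Mx^2/\alpha$ for all $x\ge0$; and $\phi_{\alpha_1}'(x)\le\phi_{\alpha_2}'(x)$ for all $x\ge 0$ whenever $\alpha_1\le\alpha_2$. Put $\beta(\mathcal F,\alpha)=\sup_{f\in\mathcal F,\,z\in\mathcal Z}\phi_\alpha'(f(z))$. For $f,g\in\mathcal F$ let $d_e(f,g)=(\mathrm E[(f(Z)-g(Z))^2])^{1/2}$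 and $d_m(f,g)=\sup_{z\in\mathcal Z}|f(z)-g(z)|\in[0,\infty]$. For $p>0$, a set $T$ and a distance $d$ on $T$ let $$\gamma_p(T,d)=\inf_{(\mathcal A_k)}\ \sup_{t\in T}\ \sum_{k\ge0}2^{k/p}\,\Delta(A_k(t),d)\in[0,\infty],$$ where the infimum is over all sequences $(\mathcal A_k)_{k\ge0}$ of partitions of $T$, each refining the previous one, with $\#\mathcal A_0=1$ and $\#\mathcal A_k\le2^{2^k}$ for $k\ge1$, where $A_k(t)$ is the cell of $\mathcal A_k$ containing $t$, and where $\Delta(A,d)$ is the diameter of $A$ under $d$. Then $\beta(\mathcal F,\alpha)\in[0,1]$ for every $\alpha>0$, with $\beta(\mathcal F,\alpha)>0$ unless $\phi_\alpha'(f(z))=0$ for all $f\in\mathcal F$ and $z\in\mathcal Z$, and $\beta(\mathcal F,\alpha)$ is non-decreasing in $\alpha$. Moreover, there is a universal constant $C>0$ such that for all $\alpha>0$, $\delta\in(0,1/2]$ and $n\ge1$ the following holds. Let $Z_1,\dots,Z_n$ be i.i.d. with law $\mathbb D$, and let $\hat f\in\mathcal F$, depending on the sample, minimize $f\mapsto\frac1n\sum_{i=1}^n\phi_\alpha(f(Z_i))$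 over $\mathcal F$. Then with probability at least $1-\delta$, $$P(\hat f)-P(f^*)\le C\,\beta(\mathcal F,\alpha)\,\log(1/\delta)\left(\frac{\gamma_2(\mathcal F,d_e)}{\sqrt n}+\frac{\gamma_1(\mathcal F,d_m)}{n}\right)+\frac{2M\sigma^2}{\alpha},$$ with the convention $0\cdot\infty=0$ on the right-hand side. -/

import Mathlib

open MeasureTheory ProbabilityTheory Filter Topology
open scoped ENNReal NNReal

universe u v

noncomputable section

namespace TruncatedERM

/-- The derivative of `x ↦ φ α x` on the half line `[0, ∞)` (one-sided at `0`). -/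
def dphi (φ : ℝ → ℝ → ℝ) (α x : ℝ) : ℝ := derivWithin (φ α) (Set.Ici 0) x

/-- `φ α : [0, ∞) → [0, ∞)`, `α > 0`, is a family of truncation functions with constant `M`.
Only the values of `φ α` on `[0, ∞)` for `α > 0` matter.  "Smooth" means, as usual in
optimization, differentiable with Lipschitz continuous derivative. -/
structure IsTruncation (φ : ℝ → ℝ → ℝ) (M : ℝ) : Prop where
  nonneg : ∀ α, 0 < α → ∀ x, 0 ≤ x → 0 ≤ φ α x
  differentiable : ∀ α, 0 < α → DifferentiableOn ℝ (φ α) (Set.Ici 0)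
  lipschitz_deriv : ∀ α, 0 < α → ∃ L : ℝ≥0, LipschitzOnWith L (dphi φ α) (Set.Ici 0)
  deriv_zero : ∀ α, 0 < α → dphi φ α 0 = 1
  deriv_tendsto : ∀ α, 0 < α → Tendsto (dphi φ α) atTop (𝓝 0)
  deriv_antitone : ∀ α, 0 < α → AntitoneOn (dphi φ α) (Set.Ici 0)
  const_pos : 0 < M
  abs_sub_le : ∀ α, 0 < α → ∀ x, 0 ≤ x → |φ α x - x| ≤ M * x ^ 2 / α
  deriv_mono : ∀ α₁ α₂, 0 < α₁ → α₁ ≤ α₂ → ∀ x, 0 ≤ x → dphi φ α₁ x ≤ dphi φ α₂ x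

/-- The diameter of a set for an extended distance function. -/
def diam {T : Type*} (d : T → T → ℝ≥0∞) (A : Set T) : ℝ≥0∞ :=
  ⨆ s ∈ A, ⨆ t ∈ A, d s t

/-- Admissible sequences of partitions of `T`.  A partition is given by the equivalence relation
whose classes are its cells; the sequence is increasing in the sense that each partition refines
the previous one; the `0`-th partition has at most one cell, and for `k ≥ 1` the `k`-th partition
has at most `2 ^ 2 ^ k` cells. -/
structure IsAdmissible {T : Type*} (A : ℕ → Setoid T) : Prop where
  refines : ∀ k, A (k + 1) ≤ A k
  card_zero : ENat.card (Quotient (A 0)) ≤ 1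
  card_le : ∀ k, 1 ≤ k → ENat.card (Quotient (A k)) ≤ ((2 ^ 2 ^ k : ℕ) : ℕ∞)

/-- Talagrand's functional `γ_p (T, d)`; here `{s | A k s t}` is the cell of the `k`-th partition
that contains `t`. -/
def gammaFun {T : Type*} (p : ℝ) (d : T → T → ℝ≥0∞) : ℝ≥0∞ :=
  ⨅ (A : ℕ → Setoid T) (_ : IsAdmissible A),
    ⨆ t : T, ∑' k : ℕ, (2 : ℝ≥0∞) ^ ((k : ℝ) / p) * diam d {s | A k s t}

variable {𝒵 : Type*}

/-- The uniform distance `d_m`. -/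
def dM (f g : 𝒵 → ℝ) : ℝ≥0∞ := ⨆ z, ENNReal.ofReal |f z - g z|

/-- The `L²` distance `d_e`. -/
def dE [MeasurableSpace 𝒵] (D : Measure 𝒵) (f g : 𝒵 → ℝ) : ℝ≥0∞ :=
  eLpNorm (fun z => f z - g z) 2 D

/-- `β(ℱ, α)`, the supremum of `φ_α'(f(z))` over `f ∈ ℱ` and `z`. -/
def betaFun (φ : ℝ → ℝ → ℝ) (F : Set (𝒵 → ℝ)) (α : ℝ) : ℝ :=
  ⨆ q : F × 𝒵, dphi φ α (q.1.1 q.2)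

/-- The expected risk `P(f)`. -/
def risk [MeasurableSpace 𝒵] (D : Measure 𝒵) (f : 𝒵 → ℝ) : ℝ := ∫ z, f z ∂D

/-- The empirical truncated risk `P_n(φ_α(f))` on the sample `z`. -/
def empTruncRisk (φ : ℝ → ℝ → ℝ) (α : ℝ) {n : ℕ} (z : Fin n → 𝒵) (f : 𝒵 → ℝ) : ℝ :=
  (1 / (n : ℝ)) * ∑ i, φ α (f (z i))

end TruncatedERM

end

/-! The proof is a chaining bound for the centred empirical process `(Pₙ - P)(φ_α ∘ f)`, `f ∈ ℱ`
(`truncDeviation`), whose increments shrink by the factor `β(ℱ, α)`.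

Truncation costs a bias: since `|φ_α(x) - x| ≤ M x² / α`, replacing `f` by `φ_α ∘ f` moves its risk
by at most `M σ² / α` (`IsTruncation.abs_risk_sub_le`).  As `fhat` minimizes the empirical
truncated risk, its excess risk over `fstar` is at most the increment of the process between
`fhat` and `fstar` plus twice this bias (`risk_sub_risk_le`), and it remains to bound all
increments at once.

Because `φ_α'` is non-negative and non-increasing, between `f(z)` and `g(z)` it is at most
`β(ℱ, α)`, so `|φ_α(f(z)) - φ_α(g(z))| ≤ β(ℱ, α) |f(z) - g(z)|` (`IsTruncation.abs_comp_sub_le`).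
Bernstein's inequality then gives increments with a subgaussian tail at scale `β d_e / √n` and a
subexponential tail at scale `β d_m / n` (`measure_lt_edist_truncDeviation_le`).

Generic chaining along the common refinements of nearly optimal partitions for `d_e` and for `d_m`
turns these tails into `γ₂` and `γ₁` (`measure_exists_lt_edist_le`).  A link at level `j` is
determined by a cell at level `j + 1`, so there are at most `2 ^ (4 · 2 ^ j)` of them, and the
exponent `8 · 2 ^ j · log (1 / δ)` makes all of them hold together with probability `1 - δ`.  Only
countably many links are involved and the process is deterministically Lipschitz for `d_m`, so
neither separability of the process nor measurability of `fhat` plays a role.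

If `γ₂` or `γ₁` is infinite, the bound is trivial unless `β(ℱ, α) = 0`; in that case `φ_α ∘ f` is
the same function for all `f ∈ ℱ`, and the process has no increments. -/

namespace TruncatedERM

/-! ### Truncation functions -/

section Truncation

variable {𝒵 : Type*} {φ : ℝ → ℝ → ℝ} {M α : ℝ} {F : Set (𝒵 → ℝ)}

lemma IsTruncation.dphi_nonneg (h : IsTruncation φ M) (hα : 0 < α) {x : ℝ} (hx : 0 ≤ x) :
    0 ≤ dphi φ α x := by
  refine le_of_tendsto (h.deriv_tendsto α hα) ?_
  filter_upwards [eventually_ge_atTop x] with y hy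
  exact h.deriv_antitone α hα hx (hx.trans hy) hy

lemma IsTruncation.dphi_le_one (h : IsTruncation φ M) (hα : 0 < α) {x : ℝ} (hx : 0 ≤ x) :
    dphi φ α x ≤ 1 := by
  rw [← h.deriv_zero α hα]
  exact h.deriv_antitone α hα Set.self_mem_Ici hx hx

/-- Since `φ_α'` is non-increasing, between two points `x` and `y` it is largest at `min x y`. -/
lemma IsTruncation.abs_sub_le_mul (h : IsTruncation φ M) (hα : 0 < α) {x y c : ℝ} (hx : 0 ≤ x)
    (hy : 0 ≤ y) (hcx : dphi φ α x ≤ c) (hcy : dphi φ α y ≤ c) :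
    |φ α x - φ α y| ≤ c * |x - y| := by
  wlog hxy : y ≤ x generalizing x y
  · rw [abs_sub_comm, abs_sub_comm x]
    exact this hy hx hcy hcx (le_of_not_ge hxy)
  have hsub : Set.Icc y x ⊆ Set.Ici 0 := fun w hw => hy.trans hw.1
  rcases hxy.eq_or_lt with rfl | hlt
  · simp
  have hd : DifferentiableOn ℝ (φ α) (Set.Icc y x) := (h.differentiable α hα).mono hsub
  refine Convex.norm_image_sub_le_of_norm_derivWithin_le (s := Set.Icc y x) hd (fun w hw => ?_)
    (convex_Icc y x) (Set.left_mem_Icc.2 hxy) (Set.right_mem_Icc.2 hxy)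
  have hw0 : 0 ≤ w := hsub hw
  rw [derivWithin_subset hsub (uniqueDiffOn_Icc hlt w hw) (h.differentiable α hα w hw0)]
  change |dphi φ α w| ≤ c
  rw [abs_of_nonneg (h.dphi_nonneg hα hw0)]
  exact (h.deriv_antitone α hα hy hw0 hw.1).trans hcy

lemma IsTruncation.map_zero (h : IsTruncation φ M) (hα : 0 < α) : φ α 0 = 0 := by
  simpa using h.abs_sub_le α hα 0 le_rfl

lemma IsTruncation.map_le_self (h : IsTruncation φ M) (hα : 0 < α) {x : ℝ} (hx : 0 ≤ x) :
    φ α x ≤ x := by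
  have := h.abs_sub_le_mul hα hx le_rfl (h.dphi_le_one hα hx) (h.dphi_le_one hα le_rfl)
  rw [h.map_zero hα, sub_zero, sub_zero, one_mul, abs_of_nonneg hx] at this
  exact (le_abs_self _).trans this

lemma IsTruncation.measurable_comp [MeasurableSpace 𝒵] (h : IsTruncation φ M) (hα : 0 < α)
    {f : 𝒵 → ℝ} (hf : Measurable f) (hf0 : ∀ z, 0 ≤ f z) : Measurable fun z => φ α (f z) := by
  have hc : Continuous fun x : ℝ => φ α (max x 0) :=
    (h.differentiable α hα).continuousOn.comp_continuous (by fun_prop) fun x => le_max_right x 0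
  simpa [Function.comp_def, hf0] using hc.measurable.comp hf

lemma IsTruncation.bddAbove_dphi (h : IsTruncation φ M) (hα : 0 < α)
    (hF : ∀ f ∈ F, ∀ z, 0 ≤ f z) :
    BddAbove (Set.range fun q : F × 𝒵 => dphi φ α (q.1.1 q.2)) :=
  ⟨1, by rintro _ ⟨q, rfl⟩; exact h.dphi_le_one hα (hF _ q.1.2 _)⟩

lemma IsTruncation.dphi_le_betaFun (h : IsTruncation φ M) (hα : 0 < α)
    (hF : ∀ f ∈ F, ∀ z, 0 ≤ f z) {f : 𝒵 → ℝ} (hf : f ∈ F) (z : 𝒵) :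
    dphi φ α (f z) ≤ betaFun φ F α :=
  le_ciSup (h.bddAbove_dphi hα hF) ((⟨f, hf⟩, z) : F × 𝒵)

lemma IsTruncation.betaFun_mem_Icc (h : IsTruncation φ M) (hα : 0 < α)
    (hF : ∀ f ∈ F, ∀ z, 0 ≤ f z) : betaFun φ F α ∈ Set.Icc (0 : ℝ) 1 :=
  ⟨Real.iSup_nonneg fun q => h.dphi_nonneg hα (hF _ q.1.2 _),
    Real.iSup_le (fun q => h.dphi_le_one hα (hF _ q.1.2 _)) zero_le_one⟩

lemma IsTruncation.betaFun_pos (h : IsTruncation φ M) (hα : 0 < α)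
    (hF : ∀ f ∈ F, ∀ z, 0 ≤ f z) (hne : ∃ f ∈ F, ∃ z, dphi φ α (f z) ≠ 0) :
    0 < betaFun φ F α := by
  obtain ⟨f, hf, z, hz⟩ := hne
  exact (lt_of_le_of_ne (h.dphi_nonneg hα (hF f hf z)) hz.symm).trans_le
    (h.dphi_le_betaFun hα hF hf z)

lemma IsTruncation.betaFun_monotoneOn (h : IsTruncation φ M) (hF : ∀ f ∈ F, ∀ z, 0 ≤ f z) :
    MonotoneOn (betaFun φ F) (Set.Ioi 0) := fun a ha b hb hab =>
  Real.iSup_le (fun q => (h.deriv_mono a b ha hab _ (hF _ q.1.2 _)).trans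
    (h.dphi_le_betaFun hb hF q.1.2 q.2)) (h.betaFun_mem_Icc hb hF).1

/-- Truncation is `β(ℱ, α)`-Lipschitz along the losses in `ℱ`. -/
lemma IsTruncation.abs_comp_sub_le (h : IsTruncation φ M) (hα : 0 < α)
    (hF : ∀ f ∈ F, ∀ z, 0 ≤ f z) {f g : 𝒵 → ℝ} (hf : f ∈ F) (hg : g ∈ F) (z : 𝒵) :
    |φ α (f z) - φ α (g z)| ≤ betaFun φ F α * |f z - g z| :=
  h.abs_sub_le_mul hα (hF f hf z) (hF g hg z) (h.dphi_le_betaFun hα hF hf z)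
    (h.dphi_le_betaFun hα hF hg z)

lemma IsTruncation.integrable_comp [MeasurableSpace 𝒵] {D : Measure 𝒵} (h : IsTruncation φ M)
    (hα : 0 < α) {f : 𝒵 → ℝ} (hf : Measurable f) (hf0 : ∀ z, 0 ≤ f z) (hi : Integrable f D) :
    Integrable (fun z => φ α (f z)) D := by
  refine hi.mono (h.measurable_comp hα hf hf0).aestronglyMeasurable (ae_of_all _ fun z => ?_)
  rw [Real.norm_of_nonneg (h.nonneg α hα _ (hf0 z)), Real.norm_of_nonneg (hf0 z)]
  exact h.map_le_self hα (hf0 z)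

/-- The bias of truncation: replacing `f` by `φ_α ∘ f` moves the risk by at most `M σ² / α`. -/
lemma IsTruncation.abs_risk_sub_le [MeasurableSpace 𝒵] {D : Measure 𝒵} (h : IsTruncation φ M)
    (hα : 0 < α) {σ : ℝ} {f : 𝒵 → ℝ} (hf : Measurable f) (hf0 : ∀ z, 0 ≤ f z)
    (hi : Integrable f D) (hi2 : Integrable (fun z => f z ^ 2) D)
    (hσ : ∫ z, f z ^ 2 ∂D ≤ σ ^ 2) :
    |risk D (fun z => φ α (f z)) - risk D f| ≤ M * σ ^ 2 / α := by
  have hφ := h.integrable_comp hα hf hf0 hi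
  unfold risk
  rw [← integral_sub hφ hi]
  calc |∫ z, φ α (f z) - f z ∂D| ≤ ∫ z, |φ α (f z) - f z| ∂D := abs_integral_le_integral_abs
    _ ≤ ∫ z, M / α * f z ^ 2 ∂D := by
        refine integral_mono (hφ.sub hi).abs (hi2.const_mul _) fun z => ?_
        exact (h.abs_sub_le α hα _ (hf0 z)).trans_eq (by ring)
    _ = M / α * ∫ z, f z ^ 2 ∂D := integral_const_mul _ _
    _ ≤ M / α * σ ^ 2 := by
        have := h.const_pos
        gcongr
    _ = M * σ ^ 2 / α := by ring

end Truncation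

/-! ### Bernstein's inequality -/

section Bernstein

variable {𝒵 : Type*} [MeasurableSpace 𝒵]

/-- Bernstein's bound on the moment generating function, from `e^x ≤ 1 + x + x²` on `|x| ≤ 1`. -/
lemma mgf_le_exp_sq {D : Measure 𝒵} [IsProbabilityMeasure D] {Y : 𝒵 → ℝ} (hY : Measurable Y)
    {b w t : ℝ} (hb : ∀ z, |Y z| ≤ b) (h0 : ∫ z, Y z ∂D = 0) (hw : ∫ z, Y z ^ 2 ∂D ≤ w)
    (ht : 0 ≤ t) (htb : t * b ≤ 1) : mgf Y D t ≤ Real.exp (t ^ 2 * w) := by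
  have hint : Integrable Y D := .of_bound hY.aestronglyMeasurable b (ae_of_all _ hb)
  have hint2 : Integrable (fun z => Y z ^ 2) D := by
    refine .of_bound (hY.pow_const 2).aestronglyMeasurable (b ^ 2) (ae_of_all _ fun z => ?_)
    rw [Real.norm_eq_abs, abs_pow]
    exact pow_le_pow_left₀ (abs_nonneg _) (hb z) 2
  have habs : ∀ z, |t * Y z| ≤ 1 := fun z => by
    rw [abs_mul, abs_of_nonneg ht]
    exact (mul_le_mul_of_nonneg_left (hb z) ht).trans htb
  have hexp : Integrable (fun z => Real.exp (t * Y z)) D := by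
    refine .of_bound (by fun_prop) (Real.exp 1) (ae_of_all _ fun z => ?_)
    rw [Real.norm_of_nonneg (Real.exp_pos _).le, Real.exp_le_exp]
    exact (le_abs_self _).trans (habs z)
  have hR : Integrable (fun z => 1 + t * Y z) D := (integrable_const _).add (hint.const_mul t)
  have hR2 : Integrable (fun z => t ^ 2 * Y z ^ 2) D := hint2.const_mul _
  calc mgf Y D t = ∫ z, Real.exp (t * Y z) ∂D := rfl
    _ ≤ ∫ z, (1 + t * Y z) + t ^ 2 * Y z ^ 2 ∂D := by
        refine integral_mono hexp (hR.add hR2) fun z => ?_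
        have := (abs_le.1 (Real.abs_exp_sub_one_sub_id_le (habs z))).2
        simp only
        linarith [mul_pow t (Y z) 2]
    _ = 1 + t ^ 2 * ∫ z, Y z ^ 2 ∂D := by
        rw [integral_add hR hR2, integral_add (integrable_const _) (hint.const_mul t),
          integral_const_mul, integral_const_mul, h0]
        simp
    _ ≤ t ^ 2 * w + 1 := by
        rw [add_comm]
        gcongr
    _ ≤ Real.exp (t ^ 2 * w) := Real.add_one_le_exp _

/-- Bernstein's inequality for a sample `Z₁, …, Zₙ` with law `D`, in the form in which the
deviation is a function of the exponent `u`. -/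
lemma measure_lt_sum_sub_integral_le {D : Measure 𝒵} [IsProbabilityMeasure D] {Ω : Type*}
    [MeasurableSpace Ω] {μ : Measure Ω} [IsProbabilityMeasure μ] {n : ℕ} {Z : Fin n → Ω → 𝒵}
    (hZ : ∀ i, Measurable (Z i)) (hind : iIndepFun Z μ) (hD : ∀ i, μ.map (Z i) = D)
    {h : 𝒵 → ℝ} (hh : Measurable h) {b v u : ℝ} (hb : ∀ z, |h z| ≤ b) (hv : 0 ≤ v)
    (hv2 : ∫ z, h z ^ 2 ∂D ≤ v ^ 2) (hu : 0 < u) :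
    μ {ω | 2 * √u * v * √n + 4 * u * b < ∑ i, (h (Z i ω) - ∫ z, h z ∂D)} ≤
      ENNReal.ofReal (Real.exp (-u)) := by
  have hDne : Nonempty 𝒵 := D.nonempty_of_neZero
  have hb0 : 0 ≤ b := (abs_nonneg _).trans (hb hDne.some)
  have hint : Integrable h D := .of_bound hh.aestronglyMeasurable b (ae_of_all _ hb)
  set m := ∫ z, h z ∂D with hm
  have hmb : |m| ≤ b := by
    simpa using norm_integral_le_of_norm_le_const (μ := D) (f := h) (ae_of_all _ hb)
  set Y : 𝒵 → ℝ := fun z => h z - m with hY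
  have hYm : Measurable Y := hh.sub_const m
  have hYb : ∀ z, |Y z| ≤ 2 * b := fun z => (abs_sub _ _).trans (by linarith [hb z])
  have hY0 : ∫ z, Y z ∂D = 0 := by
    simp [hY, integral_sub hint (integrable_const m), ← hm]
  have hY2 : ∫ z, Y z ^ 2 ∂D ≤ v ^ 2 := by
    have h2 : Integrable (fun z => h z ^ 2) D := by
      refine .of_bound (hh.pow_const 2).aestronglyMeasurable (b ^ 2) (ae_of_all _ fun z => ?_)
      rw [Real.norm_eq_abs, abs_pow]
      exact pow_le_pow_left₀ (abs_nonneg _) (hb z) 2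
    have : ∫ z, Y z ^ 2 ∂D = ∫ z, h z ^ 2 ∂D - m ^ 2 := by
      have e : ∀ z, Y z ^ 2 = h z ^ 2 - (2 * m * h z - m ^ 2) := fun z => by simp only [hY]; ring
      simp_rw [e]
      have i1 : Integrable (fun z => 2 * m * h z) D := hint.const_mul _
      have i2 : Integrable (fun z => 2 * m * h z - m ^ 2) D := i1.sub (integrable_const _)
      rw [integral_sub h2 i2, integral_sub i1 (integrable_const _), integral_const_mul, ← hm]
      simp
      ring
    linarith [sq_nonneg m]
  -- The exponent `t = 1 / r` balances the two regimes of Bernstein's inequality.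
  set r := √n / √u * v + 2 * b with hr
  have hsu : 0 < √u := Real.sqrt_pos.2 hu
  have hsq : √u * √u = u := Real.mul_self_sqrt hu.le
  have hthr : 2 * √u * v * √n + 4 * u * b = 2 * u * r := by
    rw [hr]
    field_simp
    linear_combination (2 * √n * v) * hsq
  have hr1 : 0 ≤ √n / √u * v := by positivity
  have hr0 : 0 ≤ r := by positivity
  rw [hthr]
  rcases hr0.eq_or_lt with hr0 | hr0
  · have hbz : b = 0 := by linarith
    have hYz : ∀ z, Y z = 0 := fun z => abs_nonpos_iff.1 ((hYb z).trans (by simp [hbz]))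
    have : {ω | 2 * u * r < ∑ i, (h (Z i ω) - m)} = ∅ := by
      ext ω
      have h0 : ∑ i, (h (Z i ω) - m) = 0 := Finset.sum_eq_zero fun i _ => hYz _
      rw [Set.mem_ofPred_eq, h0, ← hr0]
      simp
    rw [this, measure_empty]
    exact zero_le
  have hmgf : ∀ i, mgf (Y ∘ Z i) μ r⁻¹ ≤ Real.exp (r⁻¹ ^ 2 * v ^ 2) := fun i => by
    have : mgf (Y ∘ Z i) μ r⁻¹ = mgf Y D r⁻¹ := by
      rw [← hD i]
      exact (mgf_map (hZ i).aemeasurable (by fun_prop)).symm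
    rw [this]
    refine mgf_le_exp_sq hYm hYb hY0 hY2 (by positivity) ?_
    rw [inv_mul_le_iff₀ hr0]
    linarith
  have hmeas : ∀ i, Measurable (Y ∘ Z i) := fun i => hYm.comp (hZ i)
  have hsum : mgf (∑ i, Y ∘ Z i) μ r⁻¹ ≤ Real.exp u := by
    rw [(hind.comp (fun _ => Y) fun _ => hYm).mgf_sum hmeas]
    calc ∏ i, mgf (Y ∘ Z i) μ r⁻¹ ≤ ∏ _i : Fin n, Real.exp (r⁻¹ ^ 2 * v ^ 2) :=
          Finset.prod_le_prod (fun i _ => mgf_nonneg) fun i _ => hmgf i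
      _ = Real.exp (n * (r⁻¹ ^ 2 * v ^ 2)) := by
          rw [Finset.prod_const, Finset.card_univ, Fintype.card_fin, ← Real.exp_nat_mul]
      _ ≤ Real.exp u := by
          rw [Real.exp_le_exp, inv_pow, inv_mul_eq_div, ← mul_div_assoc,
            div_le_iff₀ (by positivity)]
          have h1 : (√n / √u * v) ^ 2 ≤ r ^ 2 := pow_le_pow_left₀ hr1 (by linarith) 2
          have h2 : u * (√n / √u * v) ^ 2 = n * v ^ 2 := by
            rw [mul_pow, div_pow, Real.sq_sqrt hu.le, Real.sq_sqrt (Nat.cast_nonneg n)]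
            field_simp
          rw [← h2]
          gcongr
  have hsumb : ∀ ω, (∑ i, Y ∘ Z i) ω ≤ n * (2 * b) := fun ω => by
    rw [Finset.sum_apply]
    calc ∑ i, (Y ∘ Z i) ω ≤ ∑ _i : Fin n, 2 * b :=
          Finset.sum_le_sum fun i _ => (le_abs_self _).trans (hYb _)
      _ = n * (2 * b) := by simp
  have hchern := measure_ge_le_exp_mul_mgf (μ := μ) (X := ∑ i, Y ∘ Z i) (t := r⁻¹) (2 * u * r)
    (by positivity) (by
      refine .of_bound (C := Real.exp (r⁻¹ * (n * (2 * b)))) (by fun_prop)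
        (ae_of_all _ fun ω => ?_)
      rw [Real.norm_of_nonneg (Real.exp_pos _).le, Real.exp_le_exp]
      gcongr
      exact hsumb ω)
  calc μ {ω | 2 * u * r < ∑ i, (h (Z i ω) - m)} ≤ μ {ω | 2 * u * r ≤ (∑ i, Y ∘ Z i) ω} := by
        refine measure_mono fun ω hω => ?_
        simp only [Set.mem_ofPred_eq, Finset.sum_apply] at hω ⊢
        exact hω.le
    _ = ENNReal.ofReal (μ.real {ω | 2 * u * r ≤ (∑ i, Y ∘ Z i) ω}) := by simp
    _ ≤ ENNReal.ofReal (Real.exp (-u)) := by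
        refine ENNReal.ofReal_le_ofReal (hchern.trans ?_)
        calc _ ≤ Real.exp (-r⁻¹ * (2 * u * r)) * Real.exp u := by gcongr
          _ = Real.exp (-u) := by
              rw [← Real.exp_add]
              congr 1
              field_simp
              ring

/-- The two-sided form of Bernstein's inequality. -/
lemma measure_lt_abs_sum_sub_integral_le {D : Measure 𝒵} [IsProbabilityMeasure D] {Ω : Type*}
    [MeasurableSpace Ω] {μ : Measure Ω} [IsProbabilityMeasure μ] {n : ℕ} {Z : Fin n → Ω → 𝒵}
    (hZ : ∀ i, Measurable (Z i)) (hind : iIndepFun Z μ) (hD : ∀ i, μ.map (Z i) = D)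
    {h : 𝒵 → ℝ} (hh : Measurable h) {b v u : ℝ} (hb : ∀ z, |h z| ≤ b) (hv : 0 ≤ v)
    (hv2 : ∫ z, h z ^ 2 ∂D ≤ v ^ 2) (hu : 0 < u) :
    μ {ω | 2 * √u * v * √n + 4 * u * b < |∑ i, (h (Z i ω) - ∫ z, h z ∂D)|} ≤
      ENNReal.ofReal (2 * Real.exp (-u)) := by
  have h1 := measure_lt_sum_sub_integral_le hZ hind hD hh hb hv hv2 hu
  have h2 := measure_lt_sum_sub_integral_le (h := fun z => -h z) (b := b) (v := v) hZ hind hD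
    hh.neg (by simpa using hb) hv (by simpa using hv2) hu
  rw [two_mul (Real.exp _), ENNReal.ofReal_add (Real.exp_pos _).le (Real.exp_pos _).le]
  refine (measure_mono fun ω hω => ?_).trans ((measure_union_le _ _).trans (add_le_add h1 h2))
  rw [Set.mem_ofPred_eq] at hω
  rcases lt_abs.1 hω with hω | hω
  · exact Or.inl hω
  · refine Or.inr ?_
    rw [← Finset.sum_neg_distrib] at hω
    simpa only [integral_neg, neg_sub_neg, neg_sub, Set.mem_ofPred_eq] using hω

end Bernstein

end TruncatedERM

namespace TruncatedERM

/-! ### Generic chaining -/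

section Chaining

variable {T : Type*} {p : ℝ} {d : T → T → ℝ≥0∞}

lemma le_diam {A : Set T} {s t : T} (hs : s ∈ A) (ht : t ∈ A) : d s t ≤ diam d A :=
  le_iSup₂_of_le s hs (le_iSup₂_of_le t ht le_rfl)

lemma IsAdmissible.rel_zero {A : ℕ → Setoid T} (hA : IsAdmissible A) (s t : T) : A 0 s t :=
  have := (ENat.card_le_one_iff_subsingleton _).1 hA.card_zero
  Quotient.exact (Subsingleton.elim (Quotient.mk (A 0) s) (Quotient.mk (A 0) t))

lemma IsAdmissible.rel_of_rel_succ {A : ℕ → Setoid T} (hA : IsAdmissible A) {k : ℕ} {s t : T}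
    (h : A (k + 1) s t) : A k s t :=
  hA.refines k h

lemma IsAdmissible.card_le' {A : ℕ → Setoid T} (hA : IsAdmissible A) (k : ℕ) :
    ENat.card (Quotient (A k)) ≤ ((2 ^ 2 ^ k : ℕ) : ℕ∞) := by
  rcases Nat.eq_zero_or_pos k with rfl | hk
  · exact hA.card_zero.trans (by norm_num)
  · exact hA.card_le k hk

lemma isAdmissible_top : IsAdmissible fun _ : ℕ => (⊤ : Setoid T) := by
  have h : ENat.card (Quotient (⊤ : Setoid T)) ≤ 1 :=
    (ENat.card_le_one_iff_subsingleton _).2 ⟨fun a b =>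
      Quotient.inductionOn₂ a b fun _ _ => Quotient.sound trivial⟩
  refine ⟨fun _ => le_rfl, h, fun k _ => h.trans ?_⟩
  exact_mod_cast Nat.one_le_two_pow

/-- The sum over the levels of an admissible sequence that `γ_p` minimizes. -/
noncomputable def chainSum (p : ℝ) (d : T → T → ℝ≥0∞) (A : ℕ → Setoid T) (t : T) : ℝ≥0∞ :=
  ∑' k : ℕ, (2 : ℝ≥0∞) ^ ((k : ℝ) / p) * diam d {s | A k s t}

lemma IsAdmissible.le_iSup_chainSum {A : ℕ → Setoid T} (hA : IsAdmissible A) (s t : T) :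
    d s t ≤ ⨆ t, chainSum p d A t := by
  refine le_trans ?_ (le_iSup _ t)
  refine le_trans ?_ (ENNReal.le_tsum 0)
  simpa using le_diam (A := {s | A 0 s t}) (hA.rel_zero s t) (hA.rel_zero t t)

/-- The level `0` of an admissible sequence has a single cell, so `γ_p` dominates all distances. -/
lemma le_gammaFun (s t : T) : d s t ≤ gammaFun p d :=
  le_iInf₂ fun _ hA => hA.le_iSup_chainSum s t

/-- Up to a factor `2`, the infimum in a finite `γ_p` is attained. -/
lemma exists_isAdmissible_chainSum_le (h : gammaFun p d ≠ ∞) :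
    ∃ A : ℕ → Setoid T, IsAdmissible A ∧ ∀ t, chainSum p d A t ≤ 2 * gammaFun p d := by
  by_cases h0 : gammaFun p d = 0
  · refine ⟨_, isAdmissible_top, fun t => ?_⟩
    have hd : ∀ A : Set T, diam d A = 0 := fun A => by
      refine le_antisymm (iSup₂_le fun s _ => iSup₂_le fun t _ => ?_) zero_le
      exact (le_gammaFun s t).trans h0.le
    simp [chainSum, hd]
  · have hlt : gammaFun p d < 2 * gammaFun p d := by
      rw [two_mul]
      exact ENNReal.lt_add_right h h0
    obtain ⟨A, hA⟩ := iInf_lt_iff.1 hlt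
    obtain ⟨hA, hlt⟩ := iInf_lt_iff.1 hA
    exact ⟨A, hA, fun t => (le_iSup (chainSum p d A) t).trans hlt.le⟩

lemma card_quotient_inf_le {A B : Setoid T} {N : ℕ} (hA : ENat.card (Quotient A) ≤ N)
    (hB : ENat.card (Quotient B) ≤ N) :
    Finite (Quotient (A ⊓ B)) ∧ Nat.card (Quotient (A ⊓ B)) ≤ N * N := by
  have fA : Finite (Quotient A) := ENat.card_lt_top.1 (hA.trans_lt (ENat.natCast_lt_top N))
  have fB : Finite (Quotient B) := ENat.card_lt_top.1 (hB.trans_lt (ENat.natCast_lt_top N))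
  rw [ENat.card_eq_coe_natCard, Nat.cast_le] at hA hB
  let e : Quotient (A ⊓ B) → Quotient A × Quotient B :=
    Quotient.lift (fun t => (Quotient.mk A t, Quotient.mk B t)) fun s t h =>
      Prod.ext (Quotient.sound h.1) (Quotient.sound h.2)
  have he : Function.Injective e := fun a b => Quotient.inductionOn₂ a b fun s t h =>
    Quotient.sound ⟨Quotient.exact (congrArg Prod.fst h), Quotient.exact (congrArg Prod.snd h)⟩
  refine ⟨Finite.of_injective e he, (Nat.card_le_card_of_injective e he).trans ?_⟩
  rw [Nat.card_prod]
  exact Nat.mul_le_mul hA hB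

/-- The cardinality of the links at level `j`, times the tail of each link, sums to `δ`. -/
lemma card_mul_exp_le {δ : ℝ} (hδ : 0 < δ) (hδ2 : δ ≤ 1 / 2) (j : ℕ) :
    (2 ^ 2 ^ (j + 1) * 2 ^ 2 ^ (j + 1) : ℕ) * (2 * Real.exp (-(8 * 2 ^ j * Real.log (1 / δ)))) ≤
      δ * (1 / 2) ^ (j + 1) := by
  have hexp : Real.exp (-(8 * 2 ^ j * Real.log (1 / δ))) = δ ^ (8 * 2 ^ j) := by
    rw [one_div, Real.log_inv, mul_neg, neg_neg, mul_comm,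
      show (8 * 2 ^ j : ℝ) = ((8 * 2 ^ j : ℕ) : ℝ) by push_cast; rfl, ← Real.rpow_def_of_pos hδ,
      Real.rpow_natCast]
  have hj : j + 1 ≤ 2 ^ j := Nat.lt_two_pow_self
  have hcard : (2 ^ 2 ^ (j + 1) * 2 ^ 2 ^ (j + 1) : ℕ) = 2 ^ (4 * 2 ^ j) := by
    rw [← pow_add]
    congr 1
    ring
  rw [hexp, hcard]
  generalize 2 ^ j = m at hj
  obtain ⟨k, rfl⟩ : ∃ k, m = k + 1 := ⟨m - 1, by omega⟩
  calc ((2 ^ (4 * (k + 1)) : ℕ) : ℝ) * (2 * δ ^ (8 * (k + 1)))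
      = δ * (2 ^ (4 * (k + 1) + 1) * δ ^ (8 * k + 7)) := by
        push_cast
        ring
    _ ≤ δ * (2 ^ (4 * (k + 1) + 1) * (1 / 2) ^ (8 * k + 7)) := by gcongr
    _ = δ * (1 / 2) ^ (4 * k + 2) := by
        rw [show 8 * k + 7 = (4 * (k + 1) + 1) + (4 * k + 2) by ring, pow_add (1 / 2 : ℝ),
          ← mul_assoc (2 ^ _), ← mul_pow]
        norm_num
    _ ≤ δ * (1 / 2) ^ (j + 1) := by
        have : (1 / 2 : ℝ) ^ (4 * k + 2) ≤ (1 / 2) ^ (j + 1) :=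
          pow_le_pow_of_le_one (by norm_num) (by norm_num) (by omega)
        gcongr

lemma tsum_ofReal_mul_half_pow (δ : ℝ) :
    ∑' j : ℕ, ENNReal.ofReal (δ * (1 / 2) ^ (j + 1)) = ENNReal.ofReal δ := by
  have h : ∀ j : ℕ, ENNReal.ofReal (δ * (1 / 2) ^ (j + 1)) =
      ENNReal.ofReal δ * (2⁻¹ : ℝ≥0∞) ^ (j + 1) := fun j => by
    rw [ENNReal.ofReal_mul' (by positivity), ENNReal.ofReal_pow (by norm_num), one_div,
      ENNReal.ofReal_inv_of_pos (by norm_num), ENNReal.ofReal_ofNat]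
  simp_rw [h]
  rw [ENNReal.tsum_mul_left, ENNReal.tsum_geometric_add_one, ENNReal.one_sub_inv_two, inv_inv,
    ENNReal.inv_mul_cancel (by norm_num) (by norm_num), mul_one]

/-- `√(8 · 2^j L) ≤ 4 L · 2^(j/2)` as soon as `L ≥ 1/2`; this is where `δ ≤ 1/2` makes the
deviation linear in `L = log (1/δ)` in the subgaussian part also. -/
lemma ofReal_sqrt_le {l : ℝ} (hl : 1 / 2 ≤ l) (j : ℕ) :
    ENNReal.ofReal √(8 * 2 ^ j * l) ≤ ENNReal.ofReal (4 * l) * (2 : ℝ≥0∞) ^ ((j : ℝ) / 2) := by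
  have h : (2 : ℝ≥0∞) ^ ((j : ℝ) / 2) = ENNReal.ofReal √(2 ^ j) := by
    rw [Real.sqrt_eq_rpow, ← Real.rpow_natCast, ← Real.rpow_mul (by norm_num),
      ← ENNReal.ofReal_rpow_of_pos (by norm_num), ENNReal.ofReal_ofNat]
    congr 1
    ring
  rw [h, ← ENNReal.ofReal_mul (by linarith)]
  refine ENNReal.ofReal_le_ofReal (Real.sqrt_le_iff.2 ⟨by positivity, ?_⟩)
  rw [mul_pow, Real.sq_sqrt (by positivity)]
  have h2 : (0 : ℝ) < 2 ^ j := by positivity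
  nlinarith [mul_nonneg h2.le (by nlinarith : 0 ≤ l * (2 * l - 1))]

/-- Generic chaining for a process whose increments have a mixed subgaussian and subexponential
tail.  The process is Lipschitz for `d₂` with a deterministic constant, so the chains converge at
every `ω`, whatever the cardinality of `T`. -/
lemma measure_exists_lt_edist_le {Ω : Type*} [MeasurableSpace Ω] {μ : Measure Ω}
    {X : T → Ω → ℝ} {d₁ d₂ : T → T → ℝ≥0∞} {c₁ c₂ K : ℝ≥0∞} {δ : ℝ} (hδ : 0 < δ)
    (hδ2 : δ ≤ 1 / 2)
    (htail : ∀ s t, d₂ s t ≠ ∞ → ∀ u : ℝ, 0 < u →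
      μ {ω | ¬ edist (X s ω) (X t ω) ≤
        ENNReal.ofReal √u * (c₁ * d₁ s t) + ENNReal.ofReal u * (c₂ * d₂ s t)} ≤
          ENNReal.ofReal (2 * Real.exp (-u)))
    (hK : K ≠ ∞) (hlip : ∀ ω s t, edist (X s ω) (X t ω) ≤ K * d₂ s t)
    (h₁ : gammaFun 2 d₁ ≠ ∞) (h₂ : gammaFun 1 d₂ ≠ ∞) :
    μ {ω | ¬ ∀ s t, edist (X s ω) (X t ω) ≤ ENNReal.ofReal (32 * Real.log (1 / δ)) *
      (c₁ * gammaFun 2 d₁ + c₂ * gammaFun 1 d₂)} ≤ ENNReal.ofReal δ := by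
  obtain ⟨A, hA, hAs⟩ := exists_isAdmissible_chainSum_le h₁
  obtain ⟨B, hB, hBs⟩ := exists_isAdmissible_chainSum_le h₂
  set l := Real.log (1 / δ) with hl
  have hl2 : 1 / 2 ≤ l := by
    have : Real.log 2 ≤ l := Real.log_le_log (by norm_num) (by
      rw [le_div_iff₀ hδ]
      linarith)
    linarith [Real.log_two_gt_d9]
  -- `rep j t` is the representative of the cell of `t` in the common refinement at level `j`.
  let S : ℕ → Setoid T := fun j => A j ⊓ B j
  let rep : ℕ → T → T := fun j t => (Quotient.mk (S j) t).out
  have hrep : ∀ j t, S j (rep j t) t := fun j t => Quotient.exact (Quotient.out_eq _)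
  have hS : ∀ j {s t}, S (j + 1) s t → S j s t := fun j _ _ h =>
    ⟨hA.rel_of_rel_succ h.1, hB.rel_of_rel_succ h.2⟩
  have hcard := fun j => card_quotient_inf_le (hA.card_le' j) (hB.card_le' j)
  have hfin : ∀ j, Finite (Quotient (S j)) := fun j => (hcard j).1
  let bad : (j : ℕ) → Quotient (S (j + 1)) → Set Ω := fun j q =>
    {ω | ¬ edist (X (rep j q.out) ω) (X q.out ω) ≤
      ENNReal.ofReal √(8 * 2 ^ j * l) * (c₁ * d₁ (rep j q.out) q.out) +
        ENNReal.ofReal (8 * 2 ^ j * l) * (c₂ * d₂ (rep j q.out) q.out)}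
  have hbad : μ (⋃ j, ⋃ q, bad j q) ≤ ENNReal.ofReal δ := by
    rw [← tsum_ofReal_mul_half_pow δ]
    refine (measure_iUnion_le _).trans (ENNReal.tsum_le_tsum fun j => ?_)
    have := Fintype.ofFinite (Quotient (S (j + 1)))
    refine (measure_iUnion_fintype_le μ _).trans ?_
    calc ∑ q, μ (bad j q)
        ≤ ∑ _q : Quotient (S (j + 1)), ENNReal.ofReal (2 * Real.exp (-(8 * 2 ^ j * l))) :=
          Finset.sum_le_sum fun q _ => htail _ _
            (ne_top_of_le_ne_top h₂ (le_gammaFun _ _)) _ (by positivity)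
      _ = Nat.card (Quotient (S (j + 1))) *
            ENNReal.ofReal (2 * Real.exp (-(8 * 2 ^ j * l))) := by
          rw [Finset.sum_const, Finset.card_univ, nsmul_eq_mul, Nat.card_eq_fintype_card]
      _ ≤ ((2 ^ 2 ^ (j + 1) * 2 ^ 2 ^ (j + 1) : ℕ) : ℝ≥0∞) *
            ENNReal.ofReal (2 * Real.exp (-(8 * 2 ^ j * l))) := by
          gcongr
          exact (hcard (j + 1)).2
      _ ≤ ENNReal.ofReal (δ * (1 / 2) ^ (j + 1)) := by
          rw [← ENNReal.ofReal_natCast, ← ENNReal.ofReal_mul (Nat.cast_nonneg _)]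
          exact ENNReal.ofReal_le_ofReal (card_mul_exp_le hδ hδ2 j)
  refine (measure_mono fun ω hω => ?_).trans hbad
  by_contra hgood
  refine hω fun s t => ?_
  have hgood' : ∀ j q, ω ∉ bad j q := fun j q h =>
    hgood (Set.mem_iUnion.2 ⟨j, Set.mem_iUnion.2 ⟨q, h⟩⟩)
  have hchain : ∀ t, edist (X (rep 0 t) ω) (X t ω) ≤
      ENNReal.ofReal (16 * l) * (c₁ * gammaFun 2 d₁ + c₂ * gammaFun 1 d₂) := fun t => by
    have hstep : ∀ j, edist (X (rep j t) ω) (X (rep (j + 1) t) ω) ≤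
        ENNReal.ofReal (4 * l) * c₁ *
            ((2 : ℝ≥0∞) ^ ((j : ℝ) / 2) * diam d₁ {s | A j s t}) +
          ENNReal.ofReal (8 * l) * c₂ *
            ((2 : ℝ≥0∞) ^ ((j : ℝ) / 1) * diam d₂ {s | B j s t}) := fun j => by
      have hq := not_not.1 (hgood' j (Quotient.mk (S (j + 1)) t))
      change edist (X (rep j (rep (j + 1) t)) ω) (X (rep (j + 1) t) ω) ≤ _ at hq
      have hj : rep j (rep (j + 1) t) = rep j t :=
        congrArg Quotient.out (Quotient.sound (hS j (hrep (j + 1) t)))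
      have e1 : d₁ (rep j t) (rep (j + 1) t) ≤ diam d₁ {s | A j s t} :=
        le_diam (hrep j t).1 (hS j (hrep (j + 1) t)).1
      have e2 : d₂ (rep j t) (rep (j + 1) t) ≤ diam d₂ {s | B j s t} :=
        le_diam (hrep j t).2 (hS j (hrep (j + 1) t)).2
      have e3 : ENNReal.ofReal (8 * 2 ^ j * l) =
          ENNReal.ofReal (8 * l) * (2 : ℝ≥0∞) ^ ((j : ℝ) / 1) := by
        rw [div_one, ENNReal.rpow_natCast, ← ENNReal.ofReal_ofNat, ← ENNReal.ofReal_pow (by simp),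
          ← ENNReal.ofReal_mul (by linarith)]
        congr 1
        ring
      change edist _ _ ≤ ENNReal.ofReal √(8 * 2 ^ j * l) *
        (c₁ * d₁ (rep j (rep (j + 1) t)) (rep (j + 1) t)) + ENNReal.ofReal (8 * 2 ^ j * l) *
          (c₂ * d₂ (rep j (rep (j + 1) t)) (rep (j + 1) t)) at hq
      rw [hj, e3] at hq
      refine hq.trans ?_
      calc _ ≤ ENNReal.ofReal (4 * l) * (2 : ℝ≥0∞) ^ ((j : ℝ) / 2) *
              (c₁ * diam d₁ {s | A j s t}) +
            ENNReal.ofReal (8 * l) * (2 : ℝ≥0∞) ^ ((j : ℝ) / 1) *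
              (c₂ * diam d₂ {s | B j s t}) := by
            gcongr
            exact ofReal_sqrt_le hl2 j
        _ = _ := by ring
    have hlim : Tendsto (fun j => X (rep j t) ω) atTop (𝓝 (X t ω)) := by
      have hsum : chainSum 1 d₂ B t ≠ ∞ :=
        ne_top_of_le_ne_top (ENNReal.mul_ne_top (by simp) h₂) (hBs t)
      have h0 := ENNReal.tendsto_atTop_zero_of_tsum_ne_top hsum
      have h0' := ENNReal.Tendsto.const_mul (a := K) h0 (Or.inr hK)
      rw [mul_zero] at h0'
      rw [tendsto_iff_edist_tendsto_0]
      refine tendsto_of_tendsto_of_tendsto_of_le_of_le tendsto_const_nhds h0'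
        (fun _ => zero_le) fun j => (hlip ω _ _).trans ?_
      have : d₂ (rep j t) t ≤ diam d₂ {s | B j s t} := le_diam (hrep j t).2 ((B j).refl t)
      have h1 : 1 ≤ (2 : ℝ≥0∞) ^ ((j : ℝ) / 1) := by
        rw [div_one, ENNReal.rpow_natCast]
        exact one_le_pow₀ (by norm_num)
      gcongr
      exact this.trans (le_mul_of_one_le_left' h1)
    refine (edist_le_tsum_of_edist_le_of_tendsto₀ _ hstep hlim).trans ?_
    rw [ENNReal.tsum_add, ENNReal.tsum_mul_left, ENNReal.tsum_mul_left]
    calc _ ≤ ENNReal.ofReal (4 * l) * c₁ * (2 * gammaFun 2 d₁) +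
          ENNReal.ofReal (8 * l) * c₂ * (2 * gammaFun 1 d₂) := by
          gcongr
          · exact hAs t
          · exact hBs t
      _ = ENNReal.ofReal (8 * l) * (c₁ * gammaFun 2 d₁) +
          ENNReal.ofReal (16 * l) * (c₂ * gammaFun 1 d₂) := by
          rw [show 8 * l = 2 * (4 * l) by ring, show 16 * l = 2 * (2 * (4 * l)) by ring]
          simp only [ENNReal.ofReal_mul zero_le_two, ENNReal.ofReal_ofNat]
          ring
      _ ≤ ENNReal.ofReal (16 * l) * (c₁ * gammaFun 2 d₁ + c₂ * gammaFun 1 d₂) := by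
          rw [mul_add]
          gcongr
          norm_num
  have hzero : rep 0 s = rep 0 t :=
    congrArg Quotient.out (Quotient.sound ⟨hA.rel_zero s t, hB.rel_zero s t⟩)
  calc edist (X s ω) (X t ω) ≤ edist (X (rep 0 s) ω) (X s ω) + edist (X (rep 0 t) ω) (X t ω) := by
        rw [edist_comm (X (rep 0 s) ω), hzero]
        exact edist_triangle _ _ _
    _ ≤ _ := add_le_add (hchain s) (hchain t)
    _ = _ := by
        rw [← add_mul, ← ENNReal.ofReal_add (by positivity) (by positivity)]
        congr 2
        ring

end Chaining

end TruncatedERM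

namespace TruncatedERM

/-! ### The truncated empirical process -/

section EmpiricalDeviation

variable {𝒵 : Type*} {φ : ℝ → ℝ → ℝ} {M α : ℝ} {F : Set (𝒵 → ℝ)}

lemma abs_sub_le_toReal_dM {f g : 𝒵 → ℝ} (h : dM f g ≠ ∞) (z : 𝒵) :
    |f z - g z| ≤ (dM f g).toReal :=
  (ENNReal.ofReal_le_iff_le_toReal h).1 (le_iSup (fun z => ENNReal.ofReal |f z - g z|) z)

variable [MeasurableSpace 𝒵] {D : Measure 𝒵}

lemma integral_sq_eq_toReal_dE_sq {f g : 𝒵 → ℝ} (h : MemLp (fun z => f z - g z) 2 D) :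
    ∫ z, (f z - g z) ^ 2 ∂D = (dE D f g).toReal ^ 2 := by
  have h0 : 0 ≤ ∫ z, (f z - g z) ^ 2 ∂D := integral_nonneg fun z => sq_nonneg _
  rw [dE, h.eLpNorm_eq_integral_rpow_norm two_ne_zero ENNReal.ofNat_ne_top]
  simp only [ENNReal.toReal_ofNat, Real.rpow_ofNat, Real.norm_eq_abs, sq_abs]
  rw [ENNReal.toReal_ofReal (by positivity), ← Real.rpow_natCast, ← Real.rpow_mul h0]
  norm_num

/-- The centred empirical process `(Pₙ - P)(φ_α ∘ f)`. -/
noncomputable def truncDeviation (φ : ℝ → ℝ → ℝ) (α : ℝ) (D : Measure 𝒵) {n : ℕ} (z : Fin n → 𝒵)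
    (f : 𝒵 → ℝ) : ℝ :=
  empTruncRisk φ α z f - risk D fun w => φ α (f w)

lemma truncDeviation_sub {n : ℕ} (hn : 1 ≤ n) {f g : 𝒵 → ℝ}
    (hf : Integrable (fun w => φ α (f w)) D) (hg : Integrable (fun w => φ α (g w)) D)
    (z : Fin n → 𝒵) :
    truncDeviation φ α D z f - truncDeviation φ α D z g =
      (1 / (n : ℝ)) * ∑ i, (φ α (f (z i)) - φ α (g (z i)) - ∫ w, φ α (f w) - φ α (g w) ∂D) := by
  have : (n : ℝ) ≠ 0 := by positivity
  rw [integral_sub hf hg]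
  simp only [truncDeviation, empTruncRisk, risk, Finset.sum_sub_distrib, Finset.sum_const,
    Finset.card_univ, Fintype.card_fin, nsmul_eq_mul]
  field_simp
  ring

/-- The increments of the truncated process have a Bernstein tail: subgaussian for `d_e` and
subexponential for `d_m`, both scaled by the Lipschitz constant `β` of truncation. -/
lemma measure_lt_edist_truncDeviation_le [IsProbabilityMeasure D] {Ω : Type*} [MeasurableSpace Ω]
    {μ : Measure Ω} [IsProbabilityMeasure μ] {n : ℕ} (hn : 1 ≤ n) {Z : Fin n → Ω → 𝒵}
    (hZ : ∀ i, Measurable (Z i)) (hind : iIndepFun Z μ) (hD : ∀ i, μ.map (Z i) = D)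
    (hφ : IsTruncation φ M) (hα : 0 < α) (hF : ∀ f ∈ F, ∀ z, 0 ≤ f z) {f g : 𝒵 → ℝ} (hf : f ∈ F)
    (hg : g ∈ F) (hfm : Measurable f) (hgm : Measurable g) (hf2 : MemLp f 2 D)
    (hg2 : MemLp g 2 D) (hfg : dM f g ≠ ∞) {u : ℝ} (hu : 0 < u) :
    μ {ω | ¬ edist (truncDeviation φ α D (fun i => Z i ω) f)
        (truncDeviation φ α D (fun i => Z i ω) g) ≤
      ENNReal.ofReal √u * (ENNReal.ofReal (2 * betaFun φ F α) / ENNReal.ofReal √n * dE D f g) +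
        ENNReal.ofReal u * (ENNReal.ofReal (4 * betaFun φ F α) / (n : ℝ≥0∞) * dM f g)} ≤
      ENNReal.ofReal (2 * Real.exp (-u)) := by
  set β := betaFun φ F α with hβ
  have hβ0 : 0 ≤ β := (hφ.betaFun_mem_Icc hα hF).1
  have hlip : ∀ z, |φ α (f z) - φ α (g z)| ≤ β * |f z - g z| := hφ.abs_comp_sub_le hα hF hf hg
  have hfi := hφ.integrable_comp hα hfm (hF f hf) (hf2.integrable one_le_two)
  have hgi := hφ.integrable_comp hα hgm (hF g hg) (hg2.integrable one_le_two)
  have hfgL : MemLp (fun z => f z - g z) 2 D := hf2.sub hg2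
  have hdE : dE D f g ≠ ∞ := hfgL.2.ne
  have hm : Measurable fun z => φ α (f z) - φ α (g z) :=
    (hφ.measurable_comp hα hfm (hF f hf)).sub (hφ.measurable_comp hα hgm (hF g hg))
  have hb : ∀ z, |φ α (f z) - φ α (g z)| ≤ β * (dM f g).toReal := fun z =>
    (hlip z).trans (mul_le_mul_of_nonneg_left (abs_sub_le_toReal_dM hfg z) hβ0)
  have hv : ∫ z, (φ α (f z) - φ α (g z)) ^ 2 ∂D ≤ (β * (dE D f g).toReal) ^ 2 := by
    rw [mul_pow, ← integral_sq_eq_toReal_dE_sq hfgL, ← integral_const_mul]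
    refine integral_mono_of_nonneg (ae_of_all _ fun z => sq_nonneg _)
      (hfgL.integrable_sq.const_mul _) (ae_of_all _ fun z => ?_)
    have := pow_le_pow_left₀ (abs_nonneg _) (hlip z) 2
    rwa [mul_pow, sq_abs, sq_abs] at this
  refine (measure_mono fun ω hω => ?_).trans
    (measure_lt_abs_sum_sub_integral_le hZ hind hD hm hb (by positivity) hv hu)
  by_contra hle
  refine hω ?_
  rw [Set.mem_ofPred_eq, not_lt] at hle
  have hn0 : (0 : ℝ) < n := by positivity
  have hsn : 0 < √(n : ℝ) := Real.sqrt_pos.2 hn0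
  have hrhs : ENNReal.ofReal √u * (ENNReal.ofReal (2 * β) / ENNReal.ofReal √n * dE D f g) +
        ENNReal.ofReal u * (ENNReal.ofReal (4 * β) / (n : ℝ≥0∞) * dM f g) =
      ENNReal.ofReal (√u * (2 * β / √n * (dE D f g).toReal) +
        u * (4 * β / n * (dM f g).toReal)) := by
    rw [ENNReal.ofReal_add (by positivity) (by positivity),
      ENNReal.ofReal_mul (p := √u) (by positivity),
      ENNReal.ofReal_mul (p := 2 * β / √n) (by positivity), ENNReal.ofReal_div_of_pos hsn,
      ENNReal.ofReal_toReal hdE, ENNReal.ofReal_mul (p := u) hu.le,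
      ENNReal.ofReal_mul (p := 4 * β / n) (by positivity), ENNReal.ofReal_div_of_pos hn0,
      ENNReal.ofReal_toReal hfg, ENNReal.ofReal_natCast]
  rw [hrhs, edist_dist, Real.dist_eq, truncDeviation_sub hn hfi hgi, abs_mul,
    abs_of_nonneg (by positivity)]
  refine ENNReal.ofReal_le_ofReal
    ((mul_le_mul_of_nonneg_left hle (by positivity)).trans_eq ?_)
  have hsq : √(n : ℝ) ^ 2 = n := Real.sq_sqrt hn0.le
  field_simp
  linear_combination (2 * β * √u * (dE D f g).toReal) * hsq

/-- The truncated process is `2β`-Lipschitz for the uniform distance, for every sample. -/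
lemma edist_truncDeviation_le [IsProbabilityMeasure D] {n : ℕ} (hn : 1 ≤ n) (z : Fin n → 𝒵)
    (hφ : IsTruncation φ M) (hα : 0 < α) (hF : ∀ f ∈ F, ∀ z, 0 ≤ f z) {f g : 𝒵 → ℝ} (hf : f ∈ F)
    (hg : g ∈ F) (hfi : Integrable (fun w => φ α (f w)) D)
    (hgi : Integrable (fun w => φ α (g w)) D) (hfg : dM f g ≠ ∞) :
    edist (truncDeviation φ α D z f) (truncDeviation φ α D z g) ≤
      ENNReal.ofReal (2 * betaFun φ F α) * dM f g := by
  have hβ0 := (hφ.betaFun_mem_Icc hα hF).1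
  have hb : ∀ w, |φ α (f w) - φ α (g w)| ≤ betaFun φ F α * (dM f g).toReal := fun w =>
    (hφ.abs_comp_sub_le hα hF hf hg w).trans
      (mul_le_mul_of_nonneg_left (abs_sub_le_toReal_dM hfg w) hβ0)
  set b := betaFun φ F α * (dM f g).toReal with hbdef
  have hn0 : (0 : ℝ) < n := by positivity
  have hint : |∫ w, φ α (f w) - φ α (g w) ∂D| ≤ b := by
    simpa using norm_integral_le_of_norm_le_const (μ := D)
      (f := fun w => φ α (f w) - φ α (g w)) (ae_of_all _ hb)
  have hsum : |∑ i, (φ α (f (z i)) - φ α (g (z i)) - ∫ w, φ α (f w) - φ α (g w) ∂D)| ≤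
      n * (2 * b) := by
    refine (Finset.abs_sum_le_sum_abs _ _).trans ?_
    refine (Finset.sum_le_sum (g := fun _ => 2 * b) fun i _ => ?_).trans_eq (by simp)
    exact (abs_sub _ _).trans (by linarith [hb (z i)])
  rw [edist_dist, Real.dist_eq, truncDeviation_sub hn hfi hgi, abs_mul,
    abs_of_nonneg (by positivity), ← ENNReal.ofReal_toReal hfg,
    ← ENNReal.ofReal_mul (by positivity), mul_assoc 2, ← hbdef]
  refine ENNReal.ofReal_le_ofReal ?_
  rw [one_div, inv_mul_le_iff₀ hn0]
  exact hsum

/-- The basic inequality of empirical risk minimization: an empirical minimizer of the truncated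
losses has an excess risk at most an increment of the process, up to twice the bias. -/
lemma risk_sub_risk_le [IsProbabilityMeasure D] {σ : ℝ} (hφ : IsTruncation φ M) (hα : 0 < α)
    (hm : ∀ f ∈ F, Measurable f) (hF : ∀ f ∈ F, ∀ z, 0 ≤ f z)
    (hi : ∀ f ∈ F, Integrable (fun z => f z ^ 2) D ∧ ∫ z, f z ^ 2 ∂D ≤ σ ^ 2) {n : ℕ}
    (z : Fin n → 𝒵) {f g : 𝒵 → ℝ} (hf : f ∈ F) (hg : g ∈ F)
    (hmin : empTruncRisk φ α z f ≤ empTruncRisk φ α z g) :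
    risk D f - risk D g ≤
      |truncDeviation φ α D z f - truncDeviation φ α D z g| + 2 * M * σ ^ 2 / α := by
  have hbias : ∀ f ∈ F, |risk D (fun z => φ α (f z)) - risk D f| ≤ M * σ ^ 2 / α := fun f hf =>
    hφ.abs_risk_sub_le hα (hm f hf) (hF f hf)
      (((memLp_two_iff_integrable_sq (hm f hf).aestronglyMeasurable).2
        (hi f hf).1).integrable one_le_two) (hi f hf).1 (hi f hf).2
  have h1 := (abs_le.1 (hbias f hf)).1
  have h2 := (abs_le.1 (hbias g hg)).2
  have h3 := neg_abs_le (truncDeviation φ α D z f - truncDeviation φ α D z g)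
  have h4 : 2 * M * σ ^ 2 / α = M * σ ^ 2 / α + M * σ ^ 2 / α := by ring
  simp only [truncDeviation] at h3 ⊢
  linarith

/-- Uniform deviation of the truncated process, by generic chaining. -/
lemma measure_exists_lt_edist_truncDeviation_le [IsProbabilityMeasure D] {Ω : Type*}
    [MeasurableSpace Ω] {μ : Measure Ω} [IsProbabilityMeasure μ] {n : ℕ} (hn : 1 ≤ n)
    {Z : Fin n → Ω → 𝒵} (hZ : ∀ i, Measurable (Z i)) (hind : iIndepFun Z μ)
    (hD : ∀ i, μ.map (Z i) = D) (hφ : IsTruncation φ M) (hα : 0 < α)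
    (hm : ∀ f ∈ F, Measurable f) (hF : ∀ f ∈ F, ∀ z, 0 ≤ f z)
    (hi : ∀ f ∈ F, Integrable (fun z => f z ^ 2) D) {δ : ℝ} (hδ : 0 < δ) (hδ2 : δ ≤ 1 / 2) :
    μ {ω | ¬ ∀ f ∈ F, ∀ g ∈ F, edist (truncDeviation φ α D (fun i => Z i ω) f)
        (truncDeviation φ α D (fun i => Z i ω) g) ≤
      ENNReal.ofReal (128 * betaFun φ F α * Real.log (1 / δ)) *
        (gammaFun 2 (fun f g : F => dE D f.1 g.1) / ENNReal.ofReal √n +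
          gammaFun 1 (fun f g : F => dM f.1 g.1) / (n : ℝ≥0∞))} ≤ ENNReal.ofReal δ := by
  have hL : ∀ f ∈ F, MemLp f 2 D := fun f hf =>
    (memLp_two_iff_integrable_sq (hm f hf).aestronglyMeasurable).2 (hi f hf)
  have hφi : ∀ f ∈ F, Integrable (fun z => φ α (f z)) D := fun f hf =>
    hφ.integrable_comp hα (hm f hf) (hF f hf) ((hL f hf).integrable one_le_two)
  have hβ0 := (hφ.betaFun_mem_Icc hα hF).1
  have hlog : 0 < Real.log (1 / δ) := Real.log_pos (by
    rw [lt_div_iff₀ hδ]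
    linarith)
  set G₂ := gammaFun 2 (fun f g : F => dE D f.1 g.1)
  set G₁ := gammaFun 1 (fun f g : F => dM f.1 g.1)
  rcases hβ0.eq_or_lt with hβ | hβ
  · -- For `β = 0` the bound is `0`, also when `γ` is infinite; but then `φ_α ∘ f` does not
    -- depend on `f ∈ ℱ`, so the process is constant.
    refine (measure_mono_null (t := ∅) (fun ω hω => ?_) measure_empty).trans_le zero_le
    refine hω fun f hf g hg => ?_
    have heq : ∀ z, φ α (f z) = φ α (g z) := fun z => by
      have := hφ.abs_comp_sub_le hα hF hf hg z
      rw [← hβ, zero_mul] at this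
      exact sub_eq_zero.1 (abs_nonpos_iff.1 this)
    simp [truncDeviation, empTruncRisk, heq]
  by_cases htop : G₂ = ∞ ∨ G₁ = ∞
  · refine (measure_mono_null (t := ∅) (fun ω hω => ?_) measure_empty).trans_le zero_le
    refine hω fun f hf g hg => ?_
    have : G₂ / ENNReal.ofReal √n + G₁ / (n : ℝ≥0∞) = ∞ := by
      rcases htop with h | h
      · simp [h, ENNReal.top_div]
      · simp [h, ENNReal.top_div]
    rw [this, ENNReal.mul_top (ENNReal.ofReal_pos.2 (by positivity)).ne']
    exact le_top
  push Not at htop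
  have hchain := measure_exists_lt_edist_le (μ := μ)
    (X := fun (f : F) ω => truncDeviation φ α D (fun i => Z i ω) f.1)
    (d₁ := fun f g : F => dE D f.1 g.1) (d₂ := fun f g : F => dM f.1 g.1)
    (c₁ := ENNReal.ofReal (2 * betaFun φ F α) / ENNReal.ofReal √n)
    (c₂ := ENNReal.ofReal (4 * betaFun φ F α) / (n : ℝ≥0∞))
    (K := ENNReal.ofReal (2 * betaFun φ F α)) hδ hδ2
    (fun f g hfg u hu => measure_lt_edist_truncDeviation_le hn hZ hind hD hφ hα hF f.2 g.2
      (hm _ f.2) (hm _ g.2) (hL _ f.2) (hL _ g.2) hfg hu) ENNReal.ofReal_ne_top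
    (fun ω f g => edist_truncDeviation_le hn _ hφ hα hF f.2 g.2 (hφi _ f.2) (hφi _ g.2)
      (ne_top_of_le_ne_top htop.2 (le_gammaFun (d := fun f g : F => dM f.1 g.1) f g)))
    htop.1 htop.2
  refine (measure_mono fun ω hω h => ?_).trans hchain
  refine hω fun f hf g hg => ?_
  refine (h ⟨f, hf⟩ ⟨g, hg⟩).trans ?_
  calc ENNReal.ofReal (32 * Real.log (1 / δ)) *
        (ENNReal.ofReal (2 * betaFun φ F α) / ENNReal.ofReal √n * G₂ +
          ENNReal.ofReal (4 * betaFun φ F α) / (n : ℝ≥0∞) * G₁)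
      ≤ ENNReal.ofReal (32 * Real.log (1 / δ)) *
        (ENNReal.ofReal (4 * betaFun φ F α) / ENNReal.ofReal √n * G₂ +
          ENNReal.ofReal (4 * betaFun φ F α) / (n : ℝ≥0∞) * G₁) := by
        gcongr
        norm_num
    _ = ENNReal.ofReal (32 * Real.log (1 / δ)) * ENNReal.ofReal (4 * betaFun φ F α) *
        (G₂ / ENNReal.ofReal √n + G₁ / (n : ℝ≥0∞)) := by
        simp only [div_eq_mul_inv]
        ring
    _ = _ := by
        rw [← ENNReal.ofReal_mul (by positivity)]
        congr 2
        ring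

end EmpiricalDeviation

end TruncatedERM

theorem theorem1 :
    ∃ C : ℝ, 0 < C ∧
      ∀ (𝒵 : Type u) [MeasurableSpace 𝒵] (D : Measure 𝒵) [IsProbabilityMeasure D]
        (F : Set (𝒵 → ℝ)) (σ : ℝ) (φ : ℝ → ℝ → ℝ) (M : ℝ) (fstar : 𝒵 → ℝ),
        -- the loss class
        (∀ f ∈ F, Measurable f) →
        (∀ f ∈ F, ∀ z, 0 ≤ f z) →
        0 < σ →
        (∀ f ∈ F, Integrable (fun z => f z ^ 2) D ∧ ∫ z, f z ^ 2 ∂D ≤ σ ^ 2) →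
        -- the truncation functions and the risk minimizer
        TruncatedERM.IsTruncation φ M →
        IsMinOn (TruncatedERM.risk D) F fstar → fstar ∈ F →
        (∀ α : ℝ, 0 < α →
          TruncatedERM.betaFun φ F α ∈ Set.Icc (0 : ℝ) 1 ∧
          ((∃ f ∈ F, ∃ z, TruncatedERM.dphi φ α (f z) ≠ 0) →
            0 < TruncatedERM.betaFun φ F α)) ∧
        MonotoneOn (TruncatedERM.betaFun φ F) (Set.Ioi 0) ∧
        ∀ (α : ℝ), 0 < α → ∀ (δ : ℝ), 0 < δ → δ ≤ 1 / 2 → ∀ (n : ℕ), 1 ≤ n →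
        -- an i.i.d. sample of size `n` and an empirical minimizer of the truncated losses
        ∀ (Ω : Type v) [MeasurableSpace Ω] (μ : Measure Ω) [IsProbabilityMeasure μ]
          (Z : Fin n → Ω → 𝒵),
          (∀ i, Measurable (Z i)) → iIndepFun Z μ → (∀ i, μ.map (Z i) = D) →
        ∀ (fhat : Ω → 𝒵 → ℝ),
          (∀ᵐ ω ∂μ, fhat ω ∈ F ∧
            IsMinOn (TruncatedERM.empTruncRisk φ α (fun i => Z i ω)) F (fhat ω)) →
          μ {ω | ¬ (ENNReal.ofReal (TruncatedERM.risk D (fhat ω) - TruncatedERM.risk D fstar) ≤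
            ENNReal.ofReal (C * TruncatedERM.betaFun φ F α * Real.log (1 / δ)) *
              (TruncatedERM.gammaFun 2 (fun f g : F => TruncatedERM.dE D f.1 g.1) /
                  ENNReal.ofReal (Real.sqrt n) +
                TruncatedERM.gammaFun 1 (fun f g : F => TruncatedERM.dM f.1 g.1) / (n : ℝ≥0∞)) +
            ENNReal.ofReal (2 * M * σ ^ 2 / α))} ≤ ENNReal.ofReal δ := by
  refine ⟨128, by norm_num, fun 𝒵 _ D _ F σ φ M fstar hm hF _ hi hφ _ hfstar =>
    ⟨fun α hα => ⟨hφ.betaFun_mem_Icc hα hF, hφ.betaFun_pos hα hF⟩, hφ.betaFun_monotoneOn hF,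
      fun α hα δ hδ hδ2 n hn Ω _ μ _ Z hZ hind hD fhat hfhat => ?_⟩⟩
  refine le_trans (measure_mono_ae ?_)
    (TruncatedERM.measure_exists_lt_edist_truncDeviation_le hn hZ hind hD hφ hα hm hF
      (fun f hf => (hi f hf).1) hδ hδ2)
  filter_upwards [hfhat] with ω ⟨hmem, hmin⟩ hω hdev
  refine hω ?_
  have hconst : 0 ≤ 2 * M * σ ^ 2 / α := by
    have := hφ.const_pos
    positivity
  have hbasic := TruncatedERM.risk_sub_risk_le hφ hα hm hF hi (fun i => Z i ω) hmem hfstar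
    (hmin hfstar)
  refine (ENNReal.ofReal_le_ofReal hbasic).trans ?_
  rw [ENNReal.ofReal_add (abs_nonneg _) hconst, ← Real.dist_eq, ← edist_dist]
  gcongr
  exact hdev _ hmem _ hfstar
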